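/- Let $S$ be a countable set and let $\mu$ be a probability measure on $\{0,1\}^S$ with the product $\sigma$-algebra. For $\epsilon\in(0,1)$ let $\mu^{(+,\epsilon)}$ be the law of the configuration obtained by first choosing an element of $\{0,1\}^S$ according to $\mu$ and then independently changing each $0$ to a $1$ with probability $\epsilon$. The measure $\mu$ is called uniformly insertion tolerant if there is an $\epsilon>0$ such that for every $s\in S$, $\mu(\sigma(s)=1\mid\sigma(S\setminus\{s\}))\ge\epsilon$ almost surely. It is called uniformly upwards extractable if there are an $\epsilon\in(0,1)$ and a probability measure $\nu$ on $\{0,1\}^S$ such that $\mu=\nu^{(+,\epsilon)}$. **Theorem.** For every countably infinite set $S$ there exists a probability measure $\mu$ on $\{0,1\}^S$ that is uniformly insertion tolerant but not uniformly upwards extractable. Moreover, for $S=\mathbb{Z}$ such a measure $\mu$ on $\{0,1\}^{\mathbb{Z}}$ can be chosen to be translation invariant. -/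

import Mathlib

open MeasureTheory ProbabilityTheory

namespace SpinMeasure

/-- The space `{0,1}^S` of configurations on `S` (`true` is `1`, `false` is `0`), with the product
`σ`-algebra. -/
abbrev Config (S : Type*) : Type _ := S → Bool

/-- The product measure `π_p` on `{0,1}^S`: independently, each site is `1` with probability `p`
and `0` with probability `1 - p`. -/
noncomputable def bernoulliProduct (S : Type*) (p : unitInterval) : Measure (Config S) :=
  Measure.infinitePi fun _ : S => bernoulliMeasure true false p

/-- The configuration obtained from `x` by changing the `0`s of `x` at the sites marked by `z`
to `1`s, all other sites being left as they are. -/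
def switchOn {S : Type*} (x z : Config S) : Config S :=
  fun s => if x s = false ∧ z s = true then true else x s

/-- The measure `μ^{(+,ε)}`: the law of the configuration obtained by choosing `x` according to `μ`
and then independently changing each `0` of `x` to a `1` with probability `ε`. The marks telling
at which sites a `0` is to be changed have law `π_ε` and are independent of `x`. -/
noncomputable def upFlip {S : Type*} (μ : Measure (Config S)) (ε : unitInterval) :
    Measure (Config S) :=
  (μ.prod (bernoulliProduct S ε)).map fun w => switchOn w.1 w.2

/-- The `σ`-algebra on `{0,1}^S` generated by the coordinates at all sites other than `s`. -/
abbrev sigmaOff {S : Type*} (s : S) : MeasurableSpace (Config S) :=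
  MeasurableSpace.comap (fun (x : Config S) (t : {t : S // t ≠ s}) => x t) MeasurableSpace.pi

/-- `μ` is `ε`-insertion tolerant: for every site `s`, the conditional probability under `μ` of a
`1` at `s`, given the configuration off `s`, is almost surely at least `ε`. -/
def IsInsertionTolerant {S : Type*} (μ : Measure (Config S)) (ε : ℝ) : Prop :=
  ∀ s : S, ∀ᵐ x ∂μ, ε ≤ (μ⟦{y : Config S | y s = true} | sigmaOff s⟧) x

/-- `μ` is uniformly insertion tolerant. -/
def IsUniformlyInsertionTolerant {S : Type*} (μ : Measure (Config S)) : Prop :=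
  ∃ ε : ℝ, 0 < ε ∧ IsInsertionTolerant μ ε

/-- `μ` is `ε`-upwards extractable: `μ = ν^{(+,ε)}` for some probability measure `ν`. -/
def IsUpwardsExtractable {S : Type*} (μ : Measure (Config S)) (ε : unitInterval) : Prop :=
  ∃ ν : Measure (Config S), IsProbabilityMeasure ν ∧ μ = upFlip ν ε

/-- `μ` is uniformly upwards extractable: it is `ε`-upwards extractable for some `ε ∈ (0,1)`. -/
def IsUniformlyUpwardsExtractable {S : Type*} (μ : Measure (Config S)) : Prop :=
  ∃ ε : unitInterval, 0 < ε ∧ ε < 1 ∧ IsUpwardsExtractable μ ε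

/-- The measure `μ` on `{0,1}^ℤ` is invariant under all translations of `ℤ`. -/
def IsTranslationInvariant (μ : Measure (Config ℤ)) : Prop :=
  ∀ n : ℤ, μ.map (fun (x : Config ℤ) (k : ℤ) => x (k + n)) = μ

end SpinMeasure

/-!
If `μ = ν^{(+,ε)}`, then given the configuration drawn from `ν` the coordinate `σ(s) - ε` has mean
`1 - ε` or `0`, independently over `s`, so `E_μ ∏_{s ∈ B} (σ(s) - ε) ≥ 0` for every finite `B`.
Take fair coins on a block of `n` sites, reweighted by `1 - ∏ (±1) / 2`. Flipping one coin changes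
probabilities by a factor of at most `3`, uniformly in `n`, so this law is insertion tolerant; but
its product over the block has mean `(1/2 - ε)^n - (1/2) (1/2)^n`, which is negative for large `n`
because `|1 - 2ε| < 1`.

To treat all `ε` at once, mix over the scales `n = 2, 4, 8, …` stationary laws on `ℤ` built from
independent blocks of size `n`. Spacing the sites of a block at distance `n` keeps the smaller
blocks of the other scales from lying inside a block of size `n`, so that these scales contribute
at most `(1/2 - ε)^n`. The mixture and the average over translations cost only a factor `n^3`,
which the decay of `|1 - 2ε|^n` beats.
-/

open scoped ENNReal NNReal

namespace SpinMeasure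

section ProductMeasure

variable {ι : Type*} {X : ι → Type*} [∀ i, MeasurableSpace (X i)] (μ : ∀ i, Measure (X i))
  [∀ i, IsProbabilityMeasure (μ i)]

lemma map_update_prod_infinitePi [DecidableEq ι] (i : ι) :
    ((μ i).prod (Measure.infinitePi μ)).map (fun w => Function.update w.2 i w.1) =
      Measure.infinitePi μ := by
  refine Measure.eq_infinitePi μ fun s t ht => ?_
  have preimage_eq : (fun w : X i × (∀ j, X j) => Function.update w.2 i w.1) ⁻¹' (s : Set ι).pi t =
      {a | i ∈ s → a ∈ t i} ×ˢ ((s.erase i : Finset ι) : Set ι).pi t := by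
    ext ⟨a, y⟩
    rw [Set.mem_preimage, Set.update_mem_pi_iff, Finset.coe_erase, and_comm]
    rfl
  rw [Measure.map_apply (by fun_prop) (MeasurableSet.pi s.countable_toSet fun j _ => ht j),
    preimage_eq, Measure.prod_prod, Measure.infinitePi_pi μ fun j _ => ht j]
  by_cases hi : i ∈ s
  · simpa only [hi, forall_const, Set.ofPred_mem_eq] using
      Finset.mul_prod_erase s (fun j => μ j (t j)) hi
  · simp [hi]

lemma map_update_infinitePi_le [DecidableEq ι] (i : ι) {φ : X i → X i} (hφ : Measurable φ)
    {C : ℝ≥0} (h : (μ i).map φ ≤ C • μ i) :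
    (Measure.infinitePi μ).map (fun y => Function.update y i (φ (y i))) ≤
      C • Measure.infinitePi μ := by
  set P := Measure.infinitePi μ
  let resample (w : X i × (∀ j, X j)) : ∀ j, X j := Function.update w.2 i w.1
  have measurable_resample : Measurable resample := by fun_prop
  have map_resample : ((μ i).prod P).map resample = P := map_update_prod_infinitePi μ i
  calc P.map (fun y => Function.update y i (φ (y i)))
      = ((μ i).prod P).map (resample ∘ Prod.map φ id) := by
        conv_lhs => rw [← map_resample, Measure.map_map (by fun_prop) measurable_resample]
        congr 1 with w : 1
        simp [resample]
    _ = (((μ i).map φ).prod P).map resample := by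
        rw [← Measure.map_map measurable_resample (by fun_prop),
          ← Measure.map_prod_map _ _ hφ measurable_id, Measure.map_id]
    _ ≤ ((C • μ i).prod P).map resample :=
        Measure.map_mono (Measure.prod_mono h le_rfl) measurable_resample
    _ = C • P := by rw [Measure.prod_smul_left, Measure.map_smul, map_resample]

lemma integral_prod_infinitePi (J : Finset ι) {g : ∀ i, X i → ℝ} (hg : ∀ i, Measurable (g i)) :
    ∫ y, ∏ i ∈ J, g i (y i) ∂Measure.infinitePi μ = ∏ i ∈ J, ∫ a, g i a ∂μ i := by
  have indep : iIndepFun (fun (i : J) (y : ∀ i, X i) => g i (y i)) (Measure.infinitePi μ) :=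
    (iIndepFun_infinitePi hg).precomp Subtype.val_injective
  have factor := indep.integral_fun_prod_eq_prod_integral fun i =>
    ((hg i).comp (measurable_pi_apply _)).aestronglyMeasurable
  simp_rw [← Finset.prod_coe_sort J]
  refine factor.trans (Finset.prod_congr rfl fun i _ => ?_)
  rw [← integral_map (measurable_pi_apply (i : ι)).aemeasurable (hg i).aestronglyMeasurable,
    Measure.infinitePi_map_eval]

end ProductMeasure

section Mixture

variable {ι Ω : Type*} [MeasurableSpace Ω] {w : ι → ℝ≥0∞} {μ : ι → Measure Ω}

/-- The mixture of the laws `μ i` with weights `w i`. -/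
noncomputable def mixture (w : ι → ℝ≥0∞) (μ : ι → Measure Ω) : Measure Ω :=
  Measure.sum fun i => w i • μ i

lemma isProbabilityMeasure_mixture [∀ i, IsProbabilityMeasure (μ i)] (hw : ∑' i, w i = 1) :
    IsProbabilityMeasure (mixture w μ) :=
  ⟨by simp [mixture, Measure.sum_apply _ MeasurableSet.univ, hw]⟩

lemma map_mixture {Ω' : Type*} [MeasurableSpace Ω'] {f : Ω → Ω'} (hf : Measurable f) :
    (mixture w μ).map f = mixture w fun i => (μ i).map f := by
  simp only [mixture, Measure.map_sum hf.aemeasurable, Measure.map_smul]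

lemma mixture_le_smul_mixture {ν : ι → Measure Ω} {C : ℝ≥0} (h : ∀ i, μ i ≤ C • ν i) :
    mixture w μ ≤ C • mixture w ν := by
  refine Measure.le_iff.2 fun A hA => ?_
  simp only [mixture, Measure.smul_apply, Measure.sum_apply _ hA, ENNReal.smul_def, smul_eq_mul]
  rw [← ENNReal.tsum_mul_left]
  refine ENNReal.tsum_le_tsum fun i => ?_
  rw [mul_left_comm]
  gcongr
  exact h i A

lemma integral_mixture_le (hw : ∑' i, w i = 1) {f : Ω → ℝ} (hf : Integrable f (mixture w μ))
    {c : ℝ} (hc : ∀ i, ∫ x, f x ∂μ i ≤ c) (i₀ : ι) :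
    ∫ x, f x ∂mixture w μ ≤ c - (w i₀).toReal * (c - ∫ x, f x ∂μ i₀) := by
  have hasSum_integral :
      HasSum (fun i => (w i).toReal * ∫ x, f x ∂μ i) (∫ x, f x ∂mixture w μ) := by
    simpa only [mixture, integral_smul_measure, smul_eq_mul] using
      hasSum_integral_measure (show Integrable f (Measure.sum fun i => w i • μ i) from hf)
  have hasSum_weight : HasSum (fun i => (w i).toReal) 1 := by
    have hw_ne_top : ∑' i, w i ≠ ∞ := by simp [hw]
    simpa [← ENNReal.tsum_toReal_eq (ENNReal.ne_top_of_tsum_ne_top hw_ne_top), hw] using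
      ENNReal.hasSum_toReal hw_ne_top
  have hasSum_gap : HasSum (fun i => (w i).toReal * (c - ∫ x, f x ∂μ i))
      (c - ∫ x, f x ∂mixture w μ) := by
    simpa only [mul_sub, one_mul] using (hasSum_weight.mul_right c).sub hasSum_integral
  have gap_le := le_hasSum hasSum_gap i₀ fun i _ =>
    mul_nonneg ENNReal.toReal_nonneg (sub_nonneg.2 (hc i))
  linarith

end Mixture

section Reindex

variable {S T : Type*}

/-- The configuration on `T` obtained from one on `S` by reading it along `e : T → S`. -/
def reindex (e : T → S) (x : Config S) : Config T :=
  fun t => x (e t)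

@[fun_prop]
lemma measurable_reindex (e : T → S) : Measurable (reindex e) :=
  measurable_pi_lambda _ fun _ => measurable_pi_apply _

instance (μ : Measure (Config S)) [IsProbabilityMeasure μ] (e : T → S) :
    IsProbabilityMeasure (μ.map (reindex e)) :=
  Measure.isProbabilityMeasure_map (measurable_reindex e).aemeasurable

lemma map_reindex_map_reindex {R : Type*} (μ : Measure (Config S)) (e : T → S) (f : R → T) :
    (μ.map (reindex e)).map (reindex f) = μ.map (reindex (e ∘ f)) :=
  Measure.map_map (measurable_reindex f) (measurable_reindex e)

instance (p : unitInterval) : IsProbabilityMeasure (bernoulliProduct S p) := by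
  unfold bernoulliProduct
  infer_instance

lemma map_reindex_bernoulliProduct {e : T → S} (he : Function.Injective e) (p : unitInterval) :
    (bernoulliProduct S p).map (reindex e) = bernoulliProduct T p :=
  Measure.map_infinitePi_infinitePi_of_inj (P := fun _ : S => bernoulliMeasure true false p) he

@[fun_prop]
lemma measurable_switchOn : Measurable fun w : Config S × Config S => switchOn w.1 w.2 := by
  refine measurable_pi_lambda _ fun s => ?_
  exact (measurable_of_finite fun b : Bool × Bool =>
    if b.1 = false ∧ b.2 = true then true else b.1).comp
      (g := fun b : Bool × Bool => if b.1 = false ∧ b.2 = true then true else b.1)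
      (f := fun w : Config S × Config S => (w.1 s, w.2 s)) (by fun_prop)

lemma map_reindex_upFlip {e : T → S} (he : Function.Injective e) (ν : Measure (Config S))
    [IsProbabilityMeasure ν] (ε : unitInterval) :
    (upFlip ν ε).map (reindex e) = upFlip (ν.map (reindex e)) ε := by
  rw [upFlip, upFlip, ← map_reindex_bernoulliProduct he,
    Measure.map_prod_map _ _ (measurable_reindex e) (measurable_reindex e),
    Measure.map_map (by fun_prop) (by fun_prop), Measure.map_map (by fun_prop) (by fun_prop)]
  rfl

lemma IsUniformlyUpwardsExtractable.map_reindex {μ : Measure (Config S)}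
    (h : IsUniformlyUpwardsExtractable μ) {e : T → S} (he : Function.Injective e) :
    IsUniformlyUpwardsExtractable (μ.map (reindex e)) := by
  obtain ⟨ε, h0, h1, ν, hν, rfl⟩ := h
  exact ⟨ε, h0, h1, ν.map (reindex e), inferInstance, map_reindex_upFlip he ν ε⟩

end Reindex

section FlipBounded

lemma sigmaOff_le {S : Type*} (s : S) : sigmaOff s ≤ MeasurableSpace.pi :=
  (measurable_pi_lambda _ fun _ => measurable_pi_apply _).comap_le

lemma measurableSet_eq_true {S : Type*} (s : S) : MeasurableSet {x : Config S | x s = true} :=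
  measurable_pi_apply (X := fun _ : S => Bool) s (measurableSet_singleton true)

variable {S T : Type*} [DecidableEq S] [DecidableEq T]

/-- The configuration obtained from `x` by changing its value at the site `s`. -/
def flipAt (s : S) (x : Config S) : Config S :=
  Function.update x s (!x s)

@[fun_prop]
lemma measurable_flipAt (s : S) : Measurable (flipAt s) := by
  have measurable_not : Measurable fun x : Config S => !x s :=
    (measurable_of_finite Bool.not).comp (measurable_pi_apply s)
  exact measurable_update'.comp (measurable_id.prodMk measurable_not)

@[simp]
lemma flipAt_flipAt (s : S) (x : Config S) : flipAt s (flipAt s x) = x := by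
  simp [flipAt]

lemma flipAt_reindex (e : T ≃ S) (t : T) (x : Config S) :
    flipAt t (reindex e x) = reindex e (flipAt (e t) x) := by
  ext t'
  simp [flipAt, reindex, Function.update_apply]

lemma preimage_flipAt_of_measurableSet_sigmaOff {s : S} {A : Set (Config S)}
    (hA : MeasurableSet[sigmaOff s] A) : flipAt s ⁻¹' A = A := by
  obtain ⟨B, -, rfl⟩ := hA
  ext x
  have agree_off : (fun t : {t : S // t ≠ s} => flipAt s x t) = fun t => x t.1 := by
    funext t
    simp [flipAt, t.2]
  simp only [Set.mem_preimage, agree_off]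

/-- Changing the value at one site multiplies probabilities under `μ` by at most `C`. -/
def FlipBounded (μ : Measure (Config S)) (C : ℝ≥0) : Prop :=
  ∀ s, μ.map (flipAt s) ≤ C • μ

lemma FlipBounded.measureReal_zero_le {μ : Measure (Config S)} [IsFiniteMeasure μ] {C : ℝ≥0}
    (h : FlipBounded μ C) {s : S} {A : Set (Config S)} (hA : MeasurableSet[sigmaOff s] A) :
    μ.real (A \ {x | x s = true}) ≤ C * μ.real (A ∩ {x | x s = true}) := by
  have preimage_eq : flipAt s ⁻¹' (A ∩ {x | x s = true}) = A \ {x | x s = true} := by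
    rw [Set.preimage_inter, preimage_flipAt_of_measurableSet_sigmaOff hA]
    ext x
    simp [flipAt]
  have measure_le := h s (A ∩ {x | x s = true})
  rw [Measure.map_apply (measurable_flipAt s)
    ((sigmaOff_le s A hA).inter (measurableSet_eq_true s)), preimage_eq] at measure_le
  simpa [measureReal_def] using ENNReal.toReal_mono (by finiteness) measure_le

lemma FlipBounded.isInsertionTolerant {μ : Measure (Config S)} [IsFiniteMeasure μ] {C : ℝ≥0}
    (h : FlipBounded μ C) : IsInsertionTolerant μ (1 / (C + 1)) := by
  intro s
  have integrable_one := (integrable_const (μ := μ) (1 : ℝ)).indicator (measurableSet_eq_true s)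
  refine ae_le_of_ae_le_trim (hm := sigmaOff_le s) (f₁ := fun _ => (1 / (C + 1) : ℝ)) ?_
  refine ae_le_of_forall_setIntegral_le (integrable_const _)
    (integrable_condExp.trim (sigmaOff_le s) stronglyMeasurable_condExp) fun A hA _ => ?_
  rw [← setIntegral_trim (sigmaOff_le s) stronglyMeasurable_const hA,
    ← setIntegral_trim (sigmaOff_le s) stronglyMeasurable_condExp hA,
    setIntegral_condExp (sigmaOff_le s) integrable_one hA,
    setIntegral_indicator (measurableSet_eq_true s), setIntegral_const, setIntegral_const,
    smul_eq_mul, smul_eq_mul, mul_one, mul_one_div, div_le_iff₀ (by positivity)]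
  have zero_le := h.measureReal_zero_le hA
  have one_add_zero := measureReal_inter_add_sdiff (μ := μ) (s := A) (measurableSet_eq_true s)
  linarith

lemma FlipBounded.isUniformlyInsertionTolerant {μ : Measure (Config S)} [IsFiniteMeasure μ]
    {C : ℝ≥0} (h : FlipBounded μ C) : IsUniformlyInsertionTolerant μ :=
  ⟨1 / (C + 1), by positivity, h.isInsertionTolerant⟩

lemma FlipBounded.mixture {ι : Type*} {w : ι → ℝ≥0∞} {μ : ι → Measure (Config S)} {C : ℝ≥0}
    (h : ∀ i, FlipBounded (μ i) C) : FlipBounded (mixture w μ) C := by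
  intro s
  rw [map_mixture (measurable_flipAt s)]
  exact mixture_le_smul_mixture fun i => h i s

lemma FlipBounded.map_reindex {μ : Measure (Config S)} {C : ℝ≥0} (h : FlipBounded μ C)
    (e : T ≃ S) : FlipBounded (μ.map (reindex e)) C := by
  intro t
  calc (μ.map (reindex e)).map (flipAt t)
      = (μ.map (flipAt (e t))).map (reindex e) := by
        rw [Measure.map_map (by fun_prop) (by fun_prop),
          Measure.map_map (by fun_prop) (by fun_prop)]
        exact congrArg μ.map (funext fun x => flipAt_reindex e t x)
    _ ≤ (C • μ).map (reindex e) := Measure.map_mono (h (e t)) (measurable_reindex e)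
    _ = C • μ.map (reindex e) := Measure.map_smul ..

lemma FlipBounded.withDensity {μ : Measure (Config S)} {C D : ℝ≥0} (h : FlipBounded μ C)
    {d : Config S → ℝ≥0∞} (hd : Measurable d) (hflip : ∀ s x, d (flipAt s x) ≤ D * d x) :
    FlipBounded (μ.withDensity d) (D * C) := by
  intro s
  refine Measure.le_iff.2 fun A hA => ?_
  rw [Measure.map_apply (measurable_flipAt s) hA, withDensity_apply _ (measurable_flipAt s hA)]
  calc ∫⁻ x in flipAt s ⁻¹' A, d x ∂μ
      = ∫⁻ x in A, d (flipAt s x) ∂μ.map (flipAt s) := by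
        rw [setLIntegral_map hA (by fun_prop) (by fun_prop)]
        simp only [flipAt_flipAt]
    _ ≤ ∫⁻ x in A, D * d x ∂(C • μ) :=
        lintegral_mono' (Measure.restrict_mono le_rfl (h s)) fun x => hflip s x
    _ = ((D * C) • μ.withDensity d) A := by
        rw [Measure.restrict_smul, lintegral_smul_measure, lintegral_const_mul _ hd,
          Measure.smul_apply, withDensity_apply _ hA, ENNReal.smul_def, ENNReal.smul_def,
          smul_eq_mul, smul_eq_mul, ENNReal.coe_mul]
        ring

end FlipBounded

section ParityLaw

variable {K : Type*}

/-- The probability `1 / 2`. -/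
noncomputable def half : unitInterval :=
  ⟨1 / 2, unitInterval.div_mem zero_le_one zero_le_two one_le_two⟩

lemma symm_half : unitInterval.symm half = half := by
  ext
  norm_num [half]

/-- The law of a family of independent fair coins. -/
noncomputable abbrev fairCoins (K : Type*) : Measure (Config K) :=
  bernoulliProduct K half

lemma flipBounded_fairCoins [DecidableEq K] : FlipBounded (fairCoins K) 1 := by
  intro k
  refine map_update_infinitePi_le (X := fun _ : K => Bool) _ k (φ := Bool.not)
    (measurable_of_finite _) (le_of_eq ?_)
  rw [map_bernoulliMeasure, bernoulliMeasure_def, bernoulliMeasure_def, symm_half, one_smul]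
  exact add_comm _ _

lemma integral_prod_fairCoins (J : Finset K) (g : K → Bool → ℝ) :
    ∫ z, ∏ k ∈ J, g k (z k) ∂fairCoins K = ∏ k ∈ J, (g k true + g k false) / 2 := by
  rw [fairCoins, bernoulliProduct, integral_prod_infinitePi _ J fun k => measurable_of_finite (g k)]
  refine Finset.prod_congr rfl fun k _ => ?_
  rw [integral_bernoulliMeasure, half, smul_eq_mul, smul_eq_mul]
  ring

/-- The spin `±1` encoded by a boolean. -/
def spin (b : Bool) : ℝ :=
  if b then 1 else -1

variable [Fintype K]

/-- The density of `parityLaw K` with respect to `fairCoins K`. It depends only on the parity of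
the number of `0`s, and disfavours configurations with an even number of them. -/
noncomputable def parityDensity (z : Config K) : ℝ :=
  1 - 1 / 2 * ∏ k, spin (z k)

lemma abs_prod_spin (z : Config K) : |∏ k, spin (z k)| = 1 := by
  rw [Finset.abs_prod]
  exact Finset.prod_eq_one fun k _ => by cases z k <;> simp [spin]

lemma parityDensity_nonneg (z : Config K) : 0 ≤ parityDensity z := by
  have prod_le := (abs_le.1 (abs_prod_spin z).le).2
  unfold parityDensity
  linarith

lemma parityDensity_le_mul (z z' : Config K) : parityDensity z ≤ 3 * parityDensity z' := by
  have le_prod := (abs_le.1 (abs_prod_spin z).le).1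
  have prod_le := (abs_le.1 (abs_prod_spin z').le).2
  unfold parityDensity
  linarith

/-- The law of a family of fair coins biased towards an odd number of `0`s: any proper subfamily
still consists of independent fair coins. -/
noncomputable def parityLaw (K : Type*) [Fintype K] : Measure (Config K) :=
  (fairCoins K).withDensity fun z => ENNReal.ofReal (parityDensity z)

lemma flipBounded_parityLaw [DecidableEq K] : FlipBounded (parityLaw K) 3 := by
  rw [← mul_one (3 : ℝ≥0)]
  refine flipBounded_fairCoins.withDensity (measurable_of_finite _) fun k z => ?_
  rw [show ((3 : ℝ≥0) : ℝ≥0∞) = ENNReal.ofReal 3 by simp, ← ENNReal.ofReal_mul (by norm_num)]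
  exact ENNReal.ofReal_le_ofReal (parityDensity_le_mul _ _)

lemma integral_parityLaw (f : Config K → ℝ) :
    ∫ z, f z ∂parityLaw K =
      ∫ z, f z ∂fairCoins K - 1 / 2 * ∫ z, (∏ k, spin (z k)) * f z ∂fairCoins K := by
  rw [parityLaw, integral_withDensity_eq_integral_toReal_smul (measurable_of_finite _)
    (Filter.Eventually.of_forall fun z => ENNReal.ofReal_lt_top),
    ← integral_const_mul, ← integral_sub .of_finite .of_finite]
  congr 1 with z
  rw [ENNReal.toReal_ofReal (parityDensity_nonneg z), smul_eq_mul, parityDensity]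
  ring

lemma integral_prod_parityLaw_univ (f : Bool → ℝ) :
    ∫ z, ∏ k, f (z k) ∂parityLaw K =
      ((f true + f false) / 2) ^ Fintype.card K -
        1 / 2 * ((f true - f false) / 2) ^ Fintype.card K := by
  simp only [integral_parityLaw, ← Finset.prod_mul_distrib]
  rw [integral_prod_fairCoins _ fun _ => f, integral_prod_fairCoins _ fun _ b => spin b * f b]
  simp only [spin, if_true, Bool.false_eq_true, if_false, one_mul, neg_one_mul, ← sub_eq_add_neg,
    Finset.prod_const, Finset.card_univ]

lemma integral_prod_parityLaw_of_ne_univ {J : Finset K} (hJ : J ≠ Finset.univ) (f : Bool → ℝ) :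
    ∫ z, ∏ k ∈ J, f (z k) ∂parityLaw K = ((f true + f false) / 2) ^ J.card := by
  classical
  obtain ⟨k₀, hk₀⟩ : ∃ k, k ∉ J := by simpa [Finset.eq_univ_iff_forall] using hJ
  have integral_spin_mul : ∫ z, (∏ k, spin (z k)) * ∏ k ∈ J, f (z k) ∂fairCoins K = 0 := by
    let g (k : K) (b : Bool) : ℝ := spin b * if k ∈ J then f b else 1
    calc ∫ z, (∏ k, spin (z k)) * ∏ k ∈ J, f (z k) ∂fairCoins K
        = ∫ z, ∏ k, g k (z k) ∂fairCoins K := by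
          simp only [g, Finset.prod_mul_distrib, Finset.prod_ite_mem, Finset.univ_inter]
      _ = ∏ k, (g k true + g k false) / 2 := integral_prod_fairCoins _ g
      _ = 0 := Finset.prod_eq_zero (Finset.mem_univ k₀) (by simp [g, hk₀, spin])
  rw [integral_parityLaw, integral_spin_mul, integral_prod_fairCoins J fun _ => f,
    Finset.prod_const, mul_zero, sub_zero]

instance [Nonempty K] : IsProbabilityMeasure (parityLaw K) := by
  have integral_one : ∫ _, 1 ∂parityLaw K = (1 : ℝ) := by
    simpa using integral_prod_parityLaw_of_ne_univ (K := K) Finset.univ_nonempty.ne_empty.symm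
      fun _ => 1
  rw [isProbabilityMeasure_iff_real]
  simpa using integral_one

end ParityLaw

section BlockLaw

variable {ι K : Type*} [Fintype K]

/-- The law of a configuration on `ι × K` whose restrictions to the blocks `{i} × K` are
independent with law `parityLaw K`. -/
noncomputable def blockLaw (ι K : Type*) [Fintype K] : Measure (Config (ι × K)) :=
  (Measure.infinitePi fun _ : ι => parityLaw K).map Function.uncurry

instance [Nonempty K] : IsProbabilityMeasure (blockLaw ι K) :=
  Measure.isProbabilityMeasure_map measurable_uncurry.aemeasurable

lemma flipBounded_blockLaw [Nonempty K] [DecidableEq ι] [DecidableEq K] :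
    FlipBounded (blockLaw ι K) 3 := by
  intro p
  let flipBlock (y : ι → Config K) := Function.update y p.1 (flipAt p.2 (y p.1))
  have measurable_flipBlock : Measurable flipBlock :=
    (measurable_update' (a := p.1)).comp (measurable_id.prodMk
      (show Measurable fun y : ι → Config K => flipAt p.2 (y p.1) by fun_prop))
  have flipAt_uncurry (y : ι → Config K) :
      flipAt p (Function.uncurry y) = Function.uncurry (flipBlock y) := by
    ext ⟨i, k⟩
    by_cases hi : i = p.1
    · simp [flipBlock, flipAt, Function.update_apply, hi, Prod.ext_iff, Function.uncurry_def]
    · simp [flipBlock, flipAt, hi, Prod.ext_iff]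
  calc (blockLaw ι K).map (flipAt p)
      = ((Measure.infinitePi fun _ : ι => parityLaw K).map flipBlock).map Function.uncurry := by
        rw [blockLaw, Measure.map_map (measurable_flipAt p) measurable_uncurry,
          Measure.map_map measurable_uncurry measurable_flipBlock]
        exact congrArg (Measure.map · _) (funext flipAt_uncurry)
    _ ≤ ((3 : ℝ≥0) • Measure.infinitePi fun _ : ι => parityLaw K).map Function.uncurry :=
        Measure.map_mono
          (map_update_infinitePi_le _ p.1 (measurable_flipAt p.2) (flipBounded_parityLaw p.2))
          measurable_uncurry
    _ = (3 : ℝ≥0) • blockLaw ι K := Measure.map_smul ..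

lemma map_reindex_blockLaw [Nonempty K] {τ : ι → ι} (hτ : Function.Injective τ) :
    (blockLaw ι K).map (reindex (Prod.map τ id)) = blockLaw ι K := by
  have map_comp : (Measure.infinitePi fun _ : ι => parityLaw K).map (fun y i => y (τ i)) =
      Measure.infinitePi fun _ : ι => parityLaw K :=
    Measure.map_infinitePi_infinitePi_of_inj (P := fun _ : ι => parityLaw K) hτ
  conv_rhs => rw [blockLaw, ← map_comp]
  rw [blockLaw, Measure.map_map (by fun_prop) measurable_uncurry,
    Measure.map_map measurable_uncurry (by fun_prop)]
  rfl

lemma integral_prod_blockLaw [Nonempty K] (D : Finset (ι × K)) (J : Finset ι)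
    (F : ι → Finset K) (hD : ∀ p, p ∈ D ↔ p.1 ∈ J ∧ p.2 ∈ F p.1) (f : Bool → ℝ) :
    ∫ x, ∏ p ∈ D, f (x p) ∂blockLaw ι K = ∏ i ∈ J, ∫ z, ∏ k ∈ F i, f (z k) ∂parityLaw K := by
  have measurable_prod : Measurable fun x : Config (ι × K) => ∏ p ∈ D, f (x p) :=
    Finset.measurable_prod _ fun p _ => (measurable_of_finite f).comp (measurable_pi_apply p)
  rw [blockLaw,
    integral_map measurable_uncurry.aemeasurable measurable_prod.aestronglyMeasurable,
    ← integral_prod_infinitePi (fun _ : ι => parityLaw K) J fun i => measurable_of_finite _]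
  simp only [Finset.prod_finset_product D J F hD, Function.uncurry_apply_pair]

lemma integral_prod_blockLaw_block [Nonempty K] (i : ι) (f : Bool → ℝ) :
    ∫ x, ∏ p ∈ {i} ×ˢ Finset.univ, f (x p) ∂blockLaw ι K =
      ((f true + f false) / 2) ^ Fintype.card K -
        1 / 2 * ((f true - f false) / 2) ^ Fintype.card K := by
  rw [integral_prod_blockLaw _ {i} (fun _ => Finset.univ) (fun p => Finset.mem_product),
    Finset.prod_singleton, integral_prod_parityLaw_univ]

lemma integral_prod_blockLaw_of_forall_exists_notMem [Nonempty K] {D : Finset (ι × K)}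
    (hD : ∀ i, ∃ k, (i, k) ∉ D) (f : Bool → ℝ) :
    ∫ x, ∏ p ∈ D, f (x p) ∂blockLaw ι K = ((f true + f false) / 2) ^ D.card := by
  classical
  let fiber (i : ι) : Finset K := {k | (i, k) ∈ D}
  have mem_iff (p : ι × K) : p ∈ D ↔ p.1 ∈ D.image Prod.fst ∧ p.2 ∈ fiber p.1 := by
    simp only [fiber, Finset.mem_filter_univ, iff_and_self]
    exact Finset.mem_image_of_mem _
  have fiber_ne_univ (i : ι) : fiber i ≠ Finset.univ := by
    obtain ⟨k, hk⟩ := hD i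
    exact fun h => hk (by simpa [fiber] using Finset.eq_univ_iff_forall.1 h k)
  rw [integral_prod_blockLaw D _ fiber mem_iff, ← Finset.prod_const,
    Finset.prod_finset_product D _ fiber mem_iff]
  refine Finset.prod_congr rfl fun i _ => ?_
  rw [integral_prod_parityLaw_of_ne_univ (fiber_ne_univ i), Finset.prod_const]

lemma integral_prod_blockLaw_le [Nonempty K] {D : Finset (ι × K)} {f : Bool → ℝ}
    (hf : f false ≤ f true) (hD : ∀ i, (∀ k, (i, k) ∈ D) → D.card ≤ Fintype.card K) :
    ∫ x, ∏ p ∈ D, f (x p) ∂blockLaw ι K ≤ ((f true + f false) / 2) ^ D.card := by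
  by_cases no_full_block : ∀ i, ∃ k, (i, k) ∉ D
  · exact (integral_prod_blockLaw_of_forall_exists_notMem no_full_block f).le
  · push Not at no_full_block
    obtain ⟨i, hi⟩ := no_full_block
    have block_subset : {i} ×ˢ Finset.univ ⊆ D := by
      rintro ⟨i', k⟩ h
      obtain rfl : i = i' := by simpa [eq_comm] using h
      exact hi k
    have card_block : (({i} : Finset ι) ×ˢ (Finset.univ : Finset K)).card = Fintype.card K := by
      simp
    obtain rfl := Finset.eq_of_subset_of_card_le block_subset (card_block ▸ hD i hi)
    rw [integral_prod_blockLaw_block, card_block]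
    exact sub_le_self _ (by have := sub_nonneg.2 hf; positivity)

end BlockLaw

section ExtractionTest

variable {S T : Type*}

/-- The factors of `extractionTest ε B`: the centred coordinate `x s - ε`. -/
def testFactor (ε : ℝ) (b : Bool) : ℝ :=
  if b then 1 - ε else -ε

/-- The product over the sites of `B` of the coordinates centred at `ε`. Flipping each `0` of `x`
to a `1` with probability `ε` turns `x s - ε` into a variable of mean `(1 - ε) x s`, so the mean of
this product under any `upFlip ν ε` is nonnegative. -/
def extractionTest (ε : ℝ) (B : Finset S) (x : Config S) : ℝ :=
  ∏ s ∈ B, testFactor ε (x s)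

@[fun_prop]
lemma measurable_extractionTest (ε : ℝ) (B : Finset S) : Measurable (extractionTest ε B) :=
  Finset.measurable_prod _ fun s _ =>
    (measurable_of_finite (testFactor ε)).comp (measurable_pi_apply s)

lemma integrable_extractionTest {ε : ℝ} (hε : ε ∈ Set.Icc 0 1) (B : Finset S)
    (μ : Measure (Config S)) [IsFiniteMeasure μ] : Integrable (extractionTest ε B) μ := by
  refine .of_bound (measurable_extractionTest ε B).aestronglyMeasurable 1 (.of_forall fun x => ?_)
  rw [extractionTest, Real.norm_eq_abs, Finset.abs_prod]
  refine Finset.prod_le_one (fun _ _ => abs_nonneg _) fun s _ => ?_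
  obtain ⟨ε_nonneg, ε_le_one⟩ := hε
  cases x s <;> simp only [testFactor, if_true, Bool.false_eq_true, if_false, abs_le] <;>
    constructor <;> linarith

lemma integral_extractionTest_map_reindex (μ : Measure (Config S)) (e : T ↪ S) (ε : ℝ)
    (B : Finset T) :
    ∫ x, extractionTest ε B x ∂μ.map (reindex e) = ∫ x, extractionTest ε (B.map e) x ∂μ := by
  rw [integral_map (by fun_prop) (by fun_prop)]
  simp only [extractionTest, reindex, Finset.prod_map]

lemma integral_extractionTest_switchOn (ε : unitInterval) (B : Finset S) (x : Config S) :
    ∫ z, extractionTest ε B (switchOn x z) ∂bernoulliProduct S ε =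
      ∏ s ∈ B, if x s then 1 - (ε : ℝ) else 0 := by
  unfold extractionTest switchOn bernoulliProduct
  rw [integral_prod_infinitePi (X := fun _ : S => Bool) _ B
    (g := fun s b => testFactor ε (if x s = false ∧ b = true then true else x s))
    fun s => measurable_of_finite _]
  refine Finset.prod_congr rfl fun s _ => ?_
  rw [integral_bernoulliMeasure]
  cases x s
  · simp only [testFactor, true_and, if_true, Bool.false_eq_true,
      if_false, smul_eq_mul]
    ring
  · simp only [testFactor, Bool.true_eq_false, false_and, if_false, if_true, smul_eq_mul]
    ring

lemma IsUpwardsExtractable.integral_extractionTest_nonneg {μ : Measure (Config S)}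
    {ε : unitInterval} (h : IsUpwardsExtractable μ ε) (B : Finset S) :
    0 ≤ ∫ x, extractionTest ε B x ∂μ := by
  obtain ⟨ν, hν, rfl⟩ := h
  have integrable := integrable_extractionTest ε.2 B
    ((ν.prod (bernoulliProduct S ε)).map fun w => switchOn w.1 w.2)
  rw [upFlip, integral_map (by fun_prop) (by fun_prop),
    integral_prod (fun w => extractionTest ε B (switchOn w.1 w.2))
      (integrable.comp_measurable measurable_switchOn)]
  refine integral_nonneg fun x => ?_
  simp only [integral_extractionTest_switchOn]
  refine Finset.prod_nonneg fun s _ => ?_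
  split_ifs
  · exact sub_nonneg.2 ε.2.2
  · exact le_rfl

end ExtractionTest

section Translation

/-- Translation of configurations on `ℤ`. -/
abbrev translate (n : ℤ) : Config ℤ → Config ℤ :=
  reindex (· + n)

lemma map_translate_map_translate (μ : Measure (Config ℤ)) (m n : ℤ) :
    (μ.map (translate m)).map (translate n) = μ.map (translate (m + n)) := by
  rw [map_reindex_map_reindex]
  congr 3 with k
  simp only [Function.comp_apply]
  ring

lemma map_translate_zero (μ : Measure (Config ℤ)) : μ.map (translate 0) = μ := by
  rw [show translate 0 = id by ext; simp [reindex], Measure.map_id]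

lemma IsTranslationInvariant.mixture {ι : Type*} {w : ι → ℝ≥0∞} {μ : ι → Measure (Config ℤ)}
    (h : ∀ i, IsTranslationInvariant (μ i)) : IsTranslationInvariant (mixture w μ) := by
  intro n
  exact (map_mixture (measurable_reindex _)).trans (congrArg _ (funext fun i => h i n))

variable {N : ℕ} {μ : Measure (Config ℤ)}

lemma map_translate_congr (h : μ.map (translate N) = μ) {a b : ℤ} (hab : (a : ZMod N) = b) :
    μ.map (translate a) = μ.map (translate b) := by
  have periodic : Function.Periodic (fun a : ℤ => μ.map (translate a)) N := by
    intro a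
    simp only [add_comm a, ← map_translate_map_translate, h]
  obtain ⟨q, hq⟩ := (ZMod.intCast_eq_intCast_iff_dvd_sub a b N).1 hab
  obtain rfl : b = a + q * N := by linarith
  exact (periodic.int_mul q a).symm

/-- The average of the translates of `μ` over one period `N`. -/
noncomputable def translationAverage (N : ℕ) (μ : Measure (Config ℤ)) : Measure (Config ℤ) :=
  mixture (fun _ : ZMod N => (N : ℝ≥0∞)⁻¹) fun j => μ.map (translate j.cast)

lemma isTranslationInvariant_translationAverage (h : μ.map (translate N) = μ) :
    IsTranslationInvariant (translationAverage N μ) := by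
  intro n
  have map_translate (j : ZMod N) : (μ.map (translate j.cast)).map (translate n) =
      μ.map (translate (j + n : ZMod N).cast) := by
    rw [map_translate_map_translate]
    exact map_translate_congr h (by simp)
  calc (translationAverage N μ).map (translate n)
      = mixture (fun _ : ZMod N => (N : ℝ≥0∞)⁻¹)
          fun j => μ.map (translate (j + n : ZMod N).cast) := by
        rw [translationAverage, map_mixture (measurable_reindex _)]
        simp only [map_translate]
    _ = translationAverage N μ :=
        Measure.sum_comp_equiv (Equiv.addRight (n : ZMod N))
          fun j => (N : ℝ≥0∞)⁻¹ • μ.map (translate j.cast)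

lemma FlipBounded.translationAverage {C : ℝ≥0} (h : FlipBounded μ C) :
    FlipBounded (translationAverage N μ) C :=
  .mixture fun j => h.map_reindex (Equiv.addRight (j.cast : ℤ))

lemma tsum_uniform_weight (N : ℕ) [NeZero N] : ∑' _ : ZMod N, (N : ℝ≥0∞)⁻¹ = 1 := by
  rw [tsum_fintype, Finset.sum_const, Finset.card_univ, ZMod.card, nsmul_eq_mul]
  exact ENNReal.mul_inv_cancel (by simpa using NeZero.ne N) (by finiteness)

variable [NeZero N]

instance [IsProbabilityMeasure μ] : IsProbabilityMeasure (translationAverage N μ) :=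
  isProbabilityMeasure_mixture (tsum_uniform_weight N)

lemma integral_translationAverage_le {f : Config ℤ → ℝ}
    (hf : Integrable f (translationAverage N μ)) {c : ℝ}
    (hc : ∀ a, ∫ x, f x ∂μ.map (translate a) ≤ c) :
    ∫ x, f x ∂translationAverage N μ ≤ c - (N : ℝ)⁻¹ * (c - ∫ x, f x ∂μ) := by
  refine (integral_mixture_le (tsum_uniform_weight N) hf (fun j => hc j.cast) 0).trans_eq ?_
  rw [ZMod.cast_zero, map_translate_zero, ENNReal.toReal_inv, ENNReal.toReal_natCast]

end Translation

section SpacedBlocks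

variable (n : ℕ) [NeZero n]

/-- The partition of `ℤ` into the blocks `{(q * n + i) * n + r | i < n}`, indexed by `q : ℤ` and
`r < n`. -/
def spacedBlocks : ℤ ≃ (ℤ × Fin n) × Fin n :=
  (Int.divModEquiv n).trans <|
    ((Int.divModEquiv n).prodCongr (Equiv.refl (Fin n))).trans
      ⟨fun p => ((p.1.1, p.2), p.1.2), fun p => ((p.1.1, p.2), p.1.2), fun _ => rfl, fun _ => rfl⟩

lemma spacedBlocks_symm_apply (q : ℤ) (r i : Fin n) :
    (spacedBlocks n).symm ((q, r), i) = (q * n + i) * n + r := rfl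

lemma spacedBlocks_add_sq (s : ℤ) :
    spacedBlocks n (s + (n ^ 2 : ℕ)) = Prod.map (Prod.map (· + 1) id) id (spacedBlocks n s) := by
  obtain ⟨⟨⟨q, r⟩, i⟩, rfl⟩ := (spacedBlocks n).symm.surjective s
  rw [Equiv.apply_symm_apply, ← Equiv.eq_symm_apply]
  simp only [Prod.map_apply, id_eq, spacedBlocks_symm_apply]
  push_cast
  ring

/-- The law of a configuration on `ℤ` that is independent with law `parityLaw (Fin n)` on each
block of `spacedBlocks n`. -/
noncomputable def spacedBlockLaw : Measure (Config ℤ) :=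
  (blockLaw (ℤ × Fin n) (Fin n)).map (reindex (spacedBlocks n))

instance : IsProbabilityMeasure (spacedBlockLaw n) := by
  unfold spacedBlockLaw
  infer_instance

lemma flipBounded_spacedBlockLaw : FlipBounded (spacedBlockLaw n) 3 :=
  flipBounded_blockLaw.map_reindex (spacedBlocks n)

lemma map_translate_spacedBlockLaw :
    (spacedBlockLaw n).map (translate (n ^ 2 : ℕ)) = spacedBlockLaw n := by
  have next_injective : Function.Injective (Prod.map (· + 1) id : ℤ × Fin n → ℤ × Fin n) :=
    (add_left_injective 1).prodMap Function.injective_id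
  rw [spacedBlockLaw, map_reindex_map_reindex]
  conv_rhs => rw [← map_reindex_blockLaw next_injective, map_reindex_map_reindex]
  exact congrArg (fun e => (blockLaw (ℤ × Fin n) (Fin n)).map (reindex e))
    (funext (spacedBlocks_add_sq n))

/-- The block `{0, n, …, (n - 1) * n}` of `spacedBlocks n`. -/
def spacedBlock : Finset ℤ :=
  (({(0, 0)} : Finset (ℤ × Fin n)) ×ˢ Finset.univ).map (spacedBlocks n).symm.toEmbedding

lemma card_spacedBlock : (spacedBlock n).card = n := by
  simp [spacedBlock]

variable {n}

lemma dvd_of_mem_spacedBlock {s : ℤ} (hs : s ∈ spacedBlock n) : (n : ℤ) ∣ s := by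
  obtain ⟨⟨⟨q, r⟩, i⟩, h, rfl⟩ := Finset.mem_map.1 hs
  obtain ⟨rfl, rfl⟩ : 0 = q ∧ 0 = r := by simpa using h
  simp [spacedBlocks_symm_apply]

lemma integral_extractionTest_spacedBlockLaw (ε : ℝ) :
    ∫ x, extractionTest ε (spacedBlock n) x ∂spacedBlockLaw n =
      (1 / 2 - ε) ^ n - 1 / 2 * (1 / 2) ^ n := by
  have map_spacedBlock : (spacedBlock n).map (spacedBlocks n).toEmbedding =
      {(0, 0)} ×ˢ (Finset.univ : Finset (Fin n)) := by
    ext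
    simp [spacedBlock]
  refine (integral_extractionTest_map_reindex _ (spacedBlocks n).toEmbedding ε _).trans ?_
  rw [map_spacedBlock]
  refine (integral_prod_blockLaw_block (0, 0) (testFactor ε)).trans ?_
  simp only [testFactor, if_true, Bool.false_eq_true, if_false, Fintype.card_fin]
  ring

/-- A block of size `m` inside a translate of `spacedBlock n` has consecutive elements at distance
`m`, a multiple of `n`; hence it can only be at least as large as `spacedBlock n`. -/
lemma integral_extractionTest_translate_spacedBlockLaw_le {m : ℕ} [NeZero m] (hm : 2 ≤ m)
    (j : ℤ) (ε : ℝ) :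
    ∫ x, extractionTest ε (spacedBlock n) x ∂(spacedBlockLaw m).map (translate j) ≤
      (1 / 2 - ε) ^ n := by
  let e : ℤ ≃ (ℤ × Fin m) × Fin m := (Equiv.addRight j).trans (spacedBlocks m)
  have mem_map (q : ℤ) (r i : Fin m) (h : ((q, r), i) ∈ (spacedBlock n).map e.toEmbedding) :
      (n : ℤ) ∣ (q * m + i) * m + r - j :=
    dvd_of_mem_spacedBlock (Finset.mem_map_equiv.1 h)
  have card_le : ∀ b, (∀ i, (b, i) ∈ (spacedBlock n).map e.toEmbedding) →
      ((spacedBlock n).map e.toEmbedding).card ≤ Fintype.card (Fin m) := by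
    rintro ⟨q, r⟩ h
    have n_dvd_m : (n : ℤ) ∣ m := by
      have dvd_gap := dvd_sub (mem_map q r _ (h ⟨1, hm⟩)) (mem_map q r _ (h ⟨0, by omega⟩))
      have gap_eq : (q * m + (1 : ℕ)) * m + r - j - ((q * m + (0 : ℕ)) * m + r - j) = (m : ℤ) := by
        push_cast
        ring
      exact gap_eq ▸ dvd_gap
    rw [Finset.card_map, card_spacedBlock, Fintype.card_fin]
    exact Nat.le_of_dvd (by omega) (Int.natCast_dvd_natCast.1 n_dvd_m)
  have testFactor_le : testFactor ε false ≤ testFactor ε true := by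
    simp [testFactor]
  rw [spacedBlockLaw, map_reindex_map_reindex]
  refine (integral_extractionTest_map_reindex _ e.toEmbedding ε _).trans_le ?_
  refine (integral_prod_blockLaw_le testFactor_le card_le).trans_eq ?_
  rw [Finset.card_map, card_spacedBlock]
  simp only [testFactor, if_true, Bool.false_eq_true, if_false]
  ring

end SpacedBlocks

section StationaryLaw

variable (n : ℕ) [NeZero n]

/-- The translation-invariant law obtained from `spacedBlockLaw n` by averaging over its period
`n ^ 2`. -/
noncomputable def stationaryLaw : Measure (Config ℤ) :=
  translationAverage (n ^ 2) (spacedBlockLaw n)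

instance : IsProbabilityMeasure (stationaryLaw n) := by
  unfold stationaryLaw
  infer_instance

lemma isTranslationInvariant_stationaryLaw : IsTranslationInvariant (stationaryLaw n) :=
  isTranslationInvariant_translationAverage (map_translate_spacedBlockLaw n)

lemma flipBounded_stationaryLaw : FlipBounded (stationaryLaw n) 3 :=
  (flipBounded_spacedBlockLaw n).translationAverage

variable {n} {ε : ℝ}

lemma integral_extractionTest_stationaryLaw_le_sub (hε : ε ∈ Set.Icc 0 1) {m : ℕ} [NeZero m]
    (hm : 2 ≤ m) :
    ∫ x, extractionTest ε (spacedBlock n) x ∂stationaryLaw m ≤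
      (1 / 2 - ε) ^ n - ((m : ℝ) ^ 2)⁻¹ *
        ((1 / 2 - ε) ^ n - ∫ x, extractionTest ε (spacedBlock n) x ∂spacedBlockLaw m) := by
  rw [← Nat.cast_pow]
  exact integral_translationAverage_le (integrable_extractionTest hε _ (stationaryLaw m))
    fun a => integral_extractionTest_translate_spacedBlockLaw_le hm a ε

lemma integral_extractionTest_stationaryLaw_le (hε : ε ∈ Set.Icc 0 1) {m : ℕ} [NeZero m]
    (hm : 2 ≤ m) :
    ∫ x, extractionTest ε (spacedBlock n) x ∂stationaryLaw m ≤ (1 / 2 - ε) ^ n := by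
  have le_untranslated := integral_extractionTest_translate_spacedBlockLaw_le (n := n) hm 0 ε
  rw [map_translate_zero] at le_untranslated
  exact (integral_extractionTest_stationaryLaw_le_sub hε hm).trans
    (sub_le_self _ (mul_nonneg (by positivity) (sub_nonneg.2 le_untranslated)))

lemma integral_extractionTest_stationaryLaw_self_le (hε : ε ∈ Set.Icc 0 1) (hn : 2 ≤ n) :
    ∫ x, extractionTest ε (spacedBlock n) x ∂stationaryLaw n ≤
      (1 / 2 - ε) ^ n - ((n : ℝ) ^ 2)⁻¹ * (1 / 2 * (1 / 2) ^ n) := by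
  simpa only [integral_extractionTest_spacedBlockLaw, sub_sub_cancel] using
    integral_extractionTest_stationaryLaw_le_sub (n := n) hε hn

end StationaryLaw

section MultiscaleLaw

/-- The mixture of the laws `stationaryLaw n` over the scales `n = 2, 4, 8, …`, in which the scale
`n` has weight `1 / n`. -/
noncomputable def multiscaleLaw : Measure (Config ℤ) :=
  mixture (fun k : ℕ => 2⁻¹ ^ (k + 1)) fun k => stationaryLaw (2 ^ (k + 1))

lemma tsum_scale_weight : ∑' k : ℕ, (2⁻¹ : ℝ≥0∞) ^ (k + 1) = 1 := by
  rw [ENNReal.tsum_geometric_add_one, ENNReal.one_sub_inv_two, inv_inv]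
  exact ENNReal.inv_mul_cancel two_ne_zero (by finiteness)

instance : IsProbabilityMeasure multiscaleLaw :=
  isProbabilityMeasure_mixture tsum_scale_weight

lemma isTranslationInvariant_multiscaleLaw : IsTranslationInvariant multiscaleLaw :=
  .mixture fun _ => isTranslationInvariant_stationaryLaw _

lemma flipBounded_multiscaleLaw : FlipBounded multiscaleLaw 3 :=
  .mixture fun _ => flipBounded_stationaryLaw _

lemma integral_extractionTest_multiscaleLaw_le {ε : ℝ} (hε : ε ∈ Set.Icc 0 1) {k n : ℕ} [NeZero n]
    (hn : n = 2 ^ (k + 1)) :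
    ∫ x, extractionTest ε (spacedBlock n) x ∂multiscaleLaw ≤
      (1 / 2 - ε) ^ n - ((n : ℝ) ^ 3)⁻¹ * (1 / 2 * (1 / 2) ^ n) := by
  have two_le_scale (k : ℕ) : 2 ≤ 2 ^ (k + 1) := Nat.le_self_pow k.succ_ne_zero 2
  have le_sub_gap : ∫ x, extractionTest ε (spacedBlock n) x ∂multiscaleLaw ≤ (1 / 2 - ε) ^ n -
      (n : ℝ)⁻¹ *
        ((1 / 2 - ε) ^ n - ∫ x, extractionTest ε (spacedBlock n) x ∂stationaryLaw n) := by
    have weight_eq : ((2⁻¹ : ℝ≥0∞) ^ (k + 1)).toReal = (n : ℝ)⁻¹ := by simp [hn]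
    rw [← weight_eq]
    subst hn
    exact integral_mixture_le tsum_scale_weight (integrable_extractionTest hε _ multiscaleLaw)
      (fun k => integral_extractionTest_stationaryLaw_le hε (two_le_scale k)) k
  have gap_ge := le_sub_comm.1
    (integral_extractionTest_stationaryLaw_self_le hε (hn.symm ▸ two_le_scale k : 2 ≤ n))
  calc ∫ x, extractionTest ε (spacedBlock n) x ∂multiscaleLaw
      ≤ _ := le_sub_gap
    _ ≤ (1 / 2 - ε) ^ n - (n : ℝ)⁻¹ * (((n : ℝ) ^ 2)⁻¹ * (1 / 2 * (1 / 2) ^ n)) := by gcongr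
    _ = (1 / 2 - ε) ^ n - ((n : ℝ) ^ 3)⁻¹ * (1 / 2 * (1 / 2) ^ n) := by ring

lemma exists_cube_mul_pow_lt {ε : ℝ} (h0 : 0 < ε) (h1 : ε < 1) :
    ∃ k : ℕ, ((2 ^ (k + 1) : ℕ) : ℝ) ^ 3 * (1 - 2 * ε) ^ 2 ^ (k + 1) < 1 / 2 := by
  have abs_lt_one : |1 - 2 * ε| < 1 := abs_lt.2 ⟨by linarith, by linarith⟩
  have tendsto_zero := (tendsto_pow_const_mul_const_pow_of_abs_lt_one 3 abs_lt_one).comp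
    ((tendsto_pow_atTop_atTop_of_one_lt one_lt_two).comp (Filter.tendsto_add_atTop_nat 1))
  exact (tendsto_zero.eventually_lt_const one_half_pos).exists

lemma not_isUniformlyUpwardsExtractable_multiscaleLaw :
    ¬ IsUniformlyUpwardsExtractable multiscaleLaw := by
  rintro ⟨ε, ε_pos, ε_lt_one, h⟩
  obtain ⟨k, hk⟩ := exists_cube_mul_pow_lt ε_pos ε_lt_one
  set n := 2 ^ (k + 1) with hn
  have n_pos : (0 : ℝ) < n := by exact_mod_cast Nat.two_pow_pos (k + 1)
  refine (h.integral_extractionTest_nonneg (spacedBlock n)).not_gt ?_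
  calc ∫ x, extractionTest ε (spacedBlock n) x ∂multiscaleLaw
      ≤ (1 / 2 - ε) ^ n - ((n : ℝ) ^ 3)⁻¹ * (1 / 2 * (1 / 2) ^ n) :=
        integral_extractionTest_multiscaleLaw_le ε.2 hn
    _ = ((n : ℝ) ^ 3 * (1 - 2 * ε) ^ n - 1 / 2) / (n ^ 3 * 2 ^ n) := by
        rw [show (1 / 2 - ε : ℝ) = (1 - 2 * ε) / 2 by ring, div_pow, one_div_pow]
        field_simp
    _ < 0 := div_neg_of_neg_of_pos (sub_neg.2 hk) (by positivity)

end MultiscaleLaw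

end SpinMeasure

theorem theorem3p2 :
    (∀ (S : Type*) [Countable S] [Infinite S],
      ∃ μ : MeasureTheory.Measure (SpinMeasure.Config S),
        MeasureTheory.IsProbabilityMeasure μ ∧
        SpinMeasure.IsUniformlyInsertionTolerant μ ∧
        ¬ SpinMeasure.IsUniformlyUpwardsExtractable μ) ∧
    (∃ μ : MeasureTheory.Measure (SpinMeasure.Config ℤ),
        MeasureTheory.IsProbabilityMeasure μ ∧
        SpinMeasure.IsTranslationInvariant μ ∧
        SpinMeasure.IsUniformlyInsertionTolerant μ ∧
        ¬ SpinMeasure.IsUniformlyUpwardsExtractable μ) := by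
  refine ⟨fun S _ _ => ?_, SpinMeasure.multiscaleLaw, inferInstance,
    SpinMeasure.isTranslationInvariant_multiscaleLaw,
    SpinMeasure.flipBounded_multiscaleLaw.isUniformlyInsertionTolerant,
    SpinMeasure.not_isUniformlyUpwardsExtractable_multiscaleLaw⟩
  classical
  obtain ⟨e⟩ := nonempty_equiv_of_countable (α := S) (β := ℤ)
  refine ⟨SpinMeasure.multiscaleLaw.map (SpinMeasure.reindex e), inferInstance,
    (SpinMeasure.flipBounded_multiscaleLaw.map_reindex e).isUniformlyInsertionTolerant,
    fun extractable => SpinMeasure.not_isUniformlyUpwardsExtractable_multiscaleLaw ?_⟩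
  have back := extractable.map_reindex e.symm.injective
  rw [SpinMeasure.map_reindex_map_reindex, e.self_comp_symm] at back
  rwa [show SpinMeasure.reindex (S := ℤ) id = id from rfl, Measure.map_id] at back
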